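/- Let $V$ be a finite set and let $\mathfrak f,\mathfrak g:2^V\to\mathbb R_{\ge 0}$ satisfy $\mathfrak f(\emptyset)=\mathfrak g(\emptyset)=0$, where $\mathfrak f$ is monotone and supermodular ($\mathfrak f(A)+\mathfrak f(B)\le \mathfrak f(A\cap B)+\mathfrak f(A\cup B)$ for all $A,B\subseteq V$) and $\mathfrak g$ is strictly monotone ($\mathfrak g(A)<\mathfrak g(B)$ whenever $A\subsetneq B$) and submodular ($\mathfrak g(A)+\mathfrak g(B)\ge \mathfrak g(A\cap B)+\mathfrak g(A\cup B)$ for all $A,B\subseteq V$). For $A,S\subseteq V$ write $h(S\mid A):=h(S\cup A)-h(A)$ for $h\in\{\mathfrak f,\mathfrak g\}$. **Density vector.** Starting with $i=1$ and $S_{<1}:=\emptyset$, and as long as $S_{<i}\ne V$, let $S_i$ be the inclusion-wise maximal set among the nonempty sets $S\subseteq V\setminus S_{<i}$ that maximize $\mathfrak f(S\mid S_{<i})/\mathfrak g(S\mid S_{<i})$; put $\rho^*_v:=\mathfrak f(S_i\mid S_{<i})/\mathfrak g(S_i\mid S_{<i})$ for every $v\in S_i$, and $S_{<i+1}:=S_{<i}\cup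 S_i$. This procedure produces a unique well-defined vector $\rho^*\in\mathbb R^V$. **Allocations.** An allocation is a pair $(x,y)\in\mathbb R_{\ge0}^V\times\mathbb R_{\ge0}^V$ with $\sum_{v\in V}x_v=\mathfrak f(V)$ and $\sum_{v\in S}x_v\ge\mathfrak f(S)$ for all $S\subseteq V$ (that is, $x$ lies in the base contrapolymatroid of $\mathfrak f$), and $\sum_{v\in V}y_v=\mathfrak g(V)$ and $\sum_{v\in S}y_v\le\mathfrak g(S)$ for all $S\subseteq V$ (that is, $y$ lies in the base polymatroid of $\mathfrak g$). The density of $v\in V$ in $(x,y)$ is $x_v/y_v$. Let $\mathcal A_0$ be the set of all allocations, and for $0\le i<|V|$ let $\mathcal A_{i+1}$ be the set of those allocations in $\mathcal A_i$ whose $(i+1)$-st largest density (counted with multiplicity) is minimum among all allocations in $\mathcal A_i$. An allocation is *lexicographically optimal* if it belongs to $\mathcal A_{|V|}$. An allocation $(x,y)$ is *locally maximin* if for every $\rho>0$ the set $S^{(\rho)}:=\{v\in V: x_v/y_v\ge\rho\}$ satisfies $\sum_{v\in S^{(\rho)}}x_v=\mathfrak f(S^{(\rho)})$ and $\sum_{v\in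 S^{(\rho)}}y_v=\mathfrak g(S^{(\rho)})$. **Theorem.** For every allocation $(x,y)$ the following are equivalent: (i) $x_v/y_v=\rho^*_v$ for all $v\in V$; (ii) $(x,y)$ is lexicographically optimal; (iii) $(x,y)$ is locally maximin. Moreover, an allocation satisfying these conditions exists. -/

import Mathlib

namespace DualModular

variable {V : Type*} [Fintype V] [DecidableEq V]

/-- A dual-modular instance on the finite ground set `V`: `f` is monotone and supermodular, `g` is
strictly monotone and submodular, and both vanish on the empty set (so both are nonnegative). -/
structure IsDualModular (f g : Finset V → ℝ) : Prop where
  f_empty : f ∅ = 0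
  g_empty : g ∅ = 0
  f_mono : Monotone f
  g_strictMono : StrictMono g
  f_supermodular : ∀ A B : Finset V, f A + f B ≤ f (A ∩ B) + f (A ∪ B)
  g_submodular : ∀ A B : Finset V, g (A ∩ B) + g (A ∪ B) ≤ g A + g B

/-- The marginal contribution `h(S | A) = h(S ∪ A) - h(A)`. -/
def marginal (h : Finset V → ℝ) (A S : Finset V) : ℝ := h (S ∪ A) - h A

/-- The marginal density `ρ(S | A) = f(S | A) / g(S | A)`. -/
noncomputable def marginalDensity (f g : Finset V → ℝ) (A S : Finset V) : ℝ :=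
  marginal f A S / marginal g A S

/-- `S` is a densest subset of the subinstance `(V \ A; f(· | A), g(· | A))`, that is, it has the
largest density among all nonempty subsets of `V \ A`. -/
def IsDensest (f g : Finset V → ℝ) (A S : Finset V) : Prop :=
  (S.Nonempty ∧ S ⊆ Finset.univ \ A) ∧
    ∀ T : Finset V, T.Nonempty → T ⊆ Finset.univ \ A →
      marginalDensity f g A T ≤ marginalDensity f g A S

/-- The union of the parts that strictly precede the `i`-th one. -/
def precedingUnion {k : ℕ} (S : Fin k → Finset V) (i : Fin k) : Finset V :=
  (Finset.univ.filter fun j : Fin k => j < i).biUnion S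

/-- `S 0, …, S (k - 1)` and `ρ` are the parts and the density vector produced by the density
decomposition: each part is the (inclusion-wise) maximal densest subset of the subinstance
that remains after the preceding parts, its elements receive its marginal density, and the
procedure stops when the ground set is exhausted. -/
structure IsDensityDecomposition (f g : Finset V → ℝ) {k : ℕ} (S : Fin k → Finset V)
    (ρ : V → ℝ) : Prop where
  maximal_densest : ∀ i, Maximal (IsDensest f g (precedingUnion S i)) (S i)
  exhausts : Finset.univ.biUnion S = (Finset.univ : Finset V)
  density_eq : ∀ i, ∀ v ∈ S i, ρ v = marginalDensity f g (precedingUnion S i) (S i)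

/-- `ρ` is the density vector of the density decomposition of `(V; f, g)`. -/
def IsDensityVector (f g : Finset V → ℝ) (ρ : V → ℝ) : Prop :=
  ∃ (k : ℕ) (S : Fin k → Finset V), IsDensityDecomposition f g S ρ

/-- The base contrapolymatroid of `f`. -/
def baseContrapolymatroid (f : Finset V → ℝ) : Set (V → ℝ) :=
  {x | (∀ v, 0 ≤ x v) ∧ ∑ v, x v = f Finset.univ ∧ ∀ S : Finset V, f S ≤ ∑ v ∈ S, x v}

/-- The base polymatroid of `g`. -/
def basePolymatroid (g : Finset V → ℝ) : Set (V → ℝ) :=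
  {y | (∀ v, 0 ≤ y v) ∧ ∑ v, y v = g Finset.univ ∧ ∀ S : Finset V, ∑ v ∈ S, y v ≤ g S}

/-- The feasible allocations, pairs of a reward vector and a cost vector. -/
def allocations (f g : Finset V → ℝ) : Set ((V → ℝ) × (V → ℝ)) :=
  baseContrapolymatroid f ×ˢ basePolymatroid g

/-- The density `x v / y v` of the agent `v` in the allocation `a = (x, y)`. -/
noncomputable def density (a : (V → ℝ) × (V → ℝ)) (v : V) : ℝ := a.1 v / a.2 v

/-- The `(i + 1)`-st largest entry (counted with multiplicity) of a real vector indexed by `V`,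
for `i < Fintype.card V`. -/
noncomputable def nthLargest (d : V → ℝ) (i : ℕ) : ℝ :=
  ((Finset.univ.val.map d).sort (· ≥ ·)).getD i 0

/-- `lexStage f g i` is the collection of allocations left after successively minimizing the
largest, the second largest, …, the `i`-th largest density. -/
def lexStage (f g : Finset V → ℝ) : ℕ → Set ((V → ℝ) × (V → ℝ))
  | 0 => allocations f g
  | i + 1 => {a | a ∈ lexStage f g i ∧
      ∀ b ∈ lexStage f g i, nthLargest (density a) i ≤ nthLargest (density b) i}

/-- Lexicographically optimal allocations. -/
def IsLexOptimal (f g : Finset V → ℝ) (a : (V → ℝ) × (V → ℝ)) : Prop :=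
  a ∈ lexStage f g (Fintype.card V)

/-- The set of agents whose density in the allocation `a` is at least `r`. -/
noncomputable def upperLevel (a : (V → ℝ) × (V → ℝ)) (r : ℝ) : Finset V :=
  Finset.univ.filter fun v => r ≤ density a v

/-- Locally maximin allocations: for every `r > 0`, the agents of density at least `r` together
receive the least possible reward and the largest possible cost. -/
def IsLocallyMaximin (f g : Finset V → ℝ) (a : (V → ℝ) × (V → ℝ)) : Prop :=
  a ∈ allocations f g ∧ ∀ r : ℝ, 0 < r →
    ∑ v ∈ upperLevel a r, a.1 v = f (upperLevel a r) ∧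
    ∑ v ∈ upperLevel a r, a.2 v = g (upperLevel a r)

end DualModular

/-! A locally maximin allocation `a` beats every allocation `b` with other densities in the
lexicographic order (`IsLocallyMaximin.sortedLexLT`). On an upper level set U of `a`, tightness and
Abel summation give ∑ d_a y_b ≤ ∑ d_a y_a = f(U) ≤ ∑ d_b y_b, so `b` cannot have densities at most
those of `a` throughout U unless they agree there. Hence, given one locally maximin `a`, both
lexicographic optimality and local maximinity of `b` amount to having the densities of `a`.

It remains to realize a density vector ρ by a locally maximin allocation. For a part S of density r
> 0 after the prefix A, the sandwich theorem puts a modular z between f(· | A)/r and g(· | A), which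
agree at S. Costs z and rewards r·z are glued over the parts (`exists_prefix_allocation`). All
prefixes become tight, and they include every upper level set because part densities do not
increase. -/

open Finset

set_option linter.unusedSectionVars false

namespace DualModular

/-! ### Separating a supermodular and a submodular function by a modular one -/

section Sandwich

variable {V : Type*} [DecidableEq V]

/-- The sandwich theorem: between a supermodular function and a submodular function above it
there is a modular one. -/
theorem exists_modular_between (S : Finset V) : ∀ p q : Finset V → ℝ, p ∅ = 0 → q ∅ = 0 →
    (∀ A ⊆ S, ∀ B ⊆ S, p A + p B ≤ p (A ∩ B) + p (A ∪ B)) →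
    (∀ A ⊆ S, ∀ B ⊆ S, q (A ∩ B) + q (A ∪ B) ≤ q A + q B) →
    (∀ A ⊆ S, p A ≤ q A) →
    ∃ z : V → ℝ, ∀ A ⊆ S, p A ≤ ∑ v ∈ A, z v ∧ ∑ v ∈ A, z v ≤ q A := by
  induction S using Finset.induction_on with
  | empty =>
    intro p q hp hq _ _ _
    refine ⟨0, fun A hA => ?_⟩
    rw [subset_empty.1 hA]
    simp [hp, hq]
  | insert v S hv ih =>
    intro p q hp hq hsup hsub hpq
    obtain ⟨T₀, hT₀, hmax⟩ := S.powerset.exists_max_image (fun T => p (insert v T) - q T)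
      ⟨∅, by simp⟩
    rw [mem_powerset] at hT₀
    simp only [mem_powerset] at hmax
    -- This will be the value at `v`: the least number meeting all the bounds p(T + v) - q(T) that a
    -- modular function below `q` and above `p` must satisfy.
    set c := p (insert v T₀) - q T₀ with hc
    have hins : ∀ {A}, A ⊆ S → insert v A ⊆ insert v S := fun h => insert_subset_insert v h
    have hsub' : ∀ {A}, A ⊆ S → A ⊆ insert v S := fun h => h.trans (subset_insert v S)
    have hnot : ∀ {A}, A ⊆ S → v ∉ A := fun h hA => hv (h hA)
    have hupper : ∀ T ⊆ S, c ≤ q (insert v T) - p T := by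
      intro T hT
      have h1 := hsup _ (hins hT₀) _ (hsub' hT)
      have h2 := hsub _ (hsub' hT₀) _ (hins hT)
      have h3 := hpq (T₀ ∩ T) (hsub' (inter_subset_left.trans hT₀))
      have h4 := hpq (insert v (T₀ ∪ T)) (hins (union_subset hT₀ hT))
      rw [insert_inter_of_notMem (hnot hT), insert_union] at h1
      rw [inter_insert_of_notMem (hnot hT₀), union_insert] at h2
      linarith
    have key : ∀ A ⊆ S, ∀ B ⊆ S,
        insert v A ∩ B = A ∩ B ∧ A ∩ insert v B = A ∩ B := fun A hA B hB =>
      ⟨insert_inter_of_notMem (hnot hB), inter_insert_of_notMem (hnot hA)⟩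
    -- Once `v` has value `c`, the bounds for T and for T + v merge into one pair of bounds on z(T).
    -- Taking the max keeps supermodularity and the min submodularity, by cases on which terms are
    -- attained.
    obtain ⟨z, hz⟩ := ih (fun T => max (p T) (p (insert v T) - c))
      (fun T => min (q T) (q (insert v T) - c))
      (by
        have := hmax ∅ (by simp)
        simp only [hp, hq] at this ⊢
        exact max_eq_left (by linarith))
      (by
        have := hupper ∅ (by simp)
        simp only [hp, hq] at this ⊢
        exact min_eq_left (by linarith))
      (by
        intro A hA B hB
        have h1 := hsup _ (hsub' hA) _ (hsub' hB)
        have h2 := hsup _ (hins hA) _ (hsub' hB)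
        have h3 := hsup _ (hsub' hA) _ (hins hB)
        have h4 := hsup _ (hins hA) _ (hins hB)
        rw [(key A hA B hB).1, insert_union] at h2
        rw [(key A hA B hB).2, union_insert] at h3
        rw [← insert_inter_distrib, ← insert_union_distrib] at h4
        have i1 := le_max_left (p (A ∩ B)) (p (insert v (A ∩ B)) - c)
        have i2 := le_max_right (p (A ∩ B)) (p (insert v (A ∩ B)) - c)
        have i3 := le_max_left (p (A ∪ B)) (p (insert v (A ∪ B)) - c)
        have i4 := le_max_right (p (A ∪ B)) (p (insert v (A ∪ B)) - c)
        rcases max_choice (p A) (p (insert v A) - c) with e | e <;>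
        rcases max_choice (p B) (p (insert v B) - c) with e' | e' <;>
        simp only [e, e'] <;> linarith)
      (by
        intro A hA B hB
        have h1 := hsub _ (hsub' hA) _ (hsub' hB)
        have h2 := hsub _ (hins hA) _ (hsub' hB)
        have h3 := hsub _ (hsub' hA) _ (hins hB)
        have h4 := hsub _ (hins hA) _ (hins hB)
        rw [(key A hA B hB).1, insert_union] at h2
        rw [(key A hA B hB).2, union_insert] at h3
        rw [← insert_inter_distrib, ← insert_union_distrib] at h4
        have i1 := min_le_left (q (A ∩ B)) (q (insert v (A ∩ B)) - c)
        have i2 := min_le_right (q (A ∩ B)) (q (insert v (A ∩ B)) - c)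
        have i3 := min_le_left (q (A ∪ B)) (q (insert v (A ∪ B)) - c)
        have i4 := min_le_right (q (A ∪ B)) (q (insert v (A ∪ B)) - c)
        rcases min_choice (q A) (q (insert v A) - c) with e | e <;>
        rcases min_choice (q B) (q (insert v B) - c) with e' | e' <;>
        simp only [e, e'] <;> linarith)
      (by
        intro A hA
        have h1 := hpq _ (hsub' hA)
        have h2 := hpq _ (hins hA)
        have h3 := hmax A hA
        have h4 := hupper A hA
        exact max_le (le_min h1 (by linarith)) (le_min (by linarith) (by linarith)))
    refine ⟨Function.update z v c, fun A hA => ?_⟩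
    have hA' : A.erase v ⊆ S := by rwa [← subset_insert_iff]
    have hsum : ∑ u ∈ A.erase v, Function.update z v c u = ∑ u ∈ A.erase v, z u :=
      sum_congr rfl fun u hu => Function.update_of_ne (ne_of_mem_erase hu) _ _
    obtain ⟨h1, h2⟩ := hz _ hA'
    obtain ⟨h3, h4⟩ := max_le_iff.1 h1
    obtain ⟨h5, h6⟩ := le_min_iff.1 h2
    by_cases hvA : v ∈ A
    · rw [← add_sum_erase A _ hvA, hsum, Function.update_self]
      rw [insert_erase hvA] at h4 h6
      constructor <;> linarith
    · rw [erase_eq_of_notMem hvA] at h3 h5 hsum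
      rw [hsum]
      exact ⟨h3, h5⟩

end Sandwich

/-! ### Abel summation over level sets, and sorted vectors -/

section Levels

variable {V : Type*} [Fintype V]

/-- Abel summation: on {d ≥ t} the weight d - c is a nonnegative combination of indicators of higher
superlevel sets. The induction peels off the smallest value of d. -/
theorem sum_superlevel_nonneg (d w : V → ℝ) : ∀ t : ℝ,
    (∀ r, t ≤ r → 0 ≤ ∑ v with r ≤ d v, w v) →
    ∀ c ≤ t, 0 ≤ ∑ v with t ≤ d v, (d v - c) * w v := by
  suffices H : ∀ n : ℕ, ∀ t : ℝ, #{v | t ≤ d v} = n →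
      (∀ r, t ≤ r → 0 ≤ ∑ v with r ≤ d v, w v) →
      ∀ c ≤ t, 0 ≤ ∑ v with t ≤ d v, (d v - c) * w v from fun t => H _ t rfl
  intro n
  induction n using Nat.strong_induction_on with
  | _ n ih =>
  intro t hn h c hct
  rcases (univ.filter fun v => t ≤ d v).eq_empty_or_nonempty with he | hne
  · simp [he]
  obtain ⟨u, hu, hmin⟩ := exists_min_image _ d hne
  simp only [mem_filter, mem_univ, true_and] at hu hmin
  have hsplit : ∑ v with t ≤ d v, (d v - c) * w v =
      (d u - c) * (∑ v with t ≤ d v, w v) + ∑ v with d u < d v, (d v - d u) * w v := by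
    have : ∑ v with d u < d v, (d v - d u) * w v = ∑ v with t ≤ d v, (d v - d u) * w v := by
      apply sum_subset
      · intro v
        simp only [mem_filter, mem_univ, true_and]
        intro hv
        linarith
      · intro v
        simp only [mem_filter, mem_univ, true_and, not_lt]
        intro hv hv'
        rw [le_antisymm hv' (hmin v hv)]
        simp
    rw [this, mul_sum, ← sum_add_distrib]
    exact sum_congr rfl fun v _ => by ring
  rw [hsplit]
  refine add_nonneg (mul_nonneg (by linarith) (h t le_rfl)) ?_
  rcases (univ.filter fun v => d u < d v).eq_empty_or_nonempty with he | hne'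
  · simp [he]
  obtain ⟨u', hu', hmin'⟩ := exists_min_image _ d hne'
  simp only [mem_filter, mem_univ, true_and] at hu' hmin'
  -- With `u'` attaining the next value, the strict superlevel set is a weak one, so induction
  -- applies at threshold `d u'` with constant `d u`.
  have heq : (univ.filter fun v => d u < d v) = univ.filter fun v => d u' ≤ d v := by
    ext v
    simp only [mem_filter, mem_univ, true_and]
    exact ⟨hmin' v, fun h => hu'.trans_le h⟩
  rw [heq]
  refine ih _ ?_ (d u') rfl (fun r hr => h r (by linarith)) _ hu'.le
  rw [← hn]
  apply card_lt_card
  rw [ssubset_iff_of_subset]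
  · exact ⟨u, by simpa using hu, by simpa using hu'⟩
  · intro v
    simp only [mem_filter, mem_univ, true_and]
    intro hv
    linarith

theorem sort_add_of_forall_le (s t : Multiset ℝ) (h : ∀ a ∈ s, ∀ b ∈ t, b ≤ a) :
    (s + t).sort (· ≥ ·) = s.sort (· ≥ ·) ++ t.sort (· ≥ ·) := by
  apply List.Perm.eq_of_pairwise' (r := (· ≥ ·))
  · exact Multiset.pairwise_sort _ _
  · rw [List.pairwise_append]
    refine ⟨Multiset.pairwise_sort _ _, Multiset.pairwise_sort _ _, fun a ha b hb => ?_⟩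
    exact h a (by simpa using ha) b (by simpa using hb)
  · rw [← Multiset.coe_eq_coe, ← Multiset.coe_add]
    simp

theorem sort_map_univ_split (d : V → ℝ) (P : V → Prop) [DecidablePred P]
    (h : ∀ u v, P u → ¬ P v → d v ≤ d u) :
    (univ.val.map d).sort (· ≥ ·) = ((univ.filter P).val.map d).sort (· ≥ ·) ++
      ((univ.filter fun v => ¬ P v).val.map d).sort (· ≥ ·) := by
  rw [← sort_add_of_forall_le]
  · rw [← Multiset.map_add, filter_val, filter_val, Multiset.filter_add_not]
  · intro a ha b hb
    simp only [Multiset.mem_map, mem_val, mem_filter, mem_univ, true_and] at ha hb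
    obtain ⟨u, hu, rfl⟩ := ha
    obtain ⟨v, hv, rfl⟩ := hb
    exact h u v hu hv

/-- The vectors `d` and `e` agree in their `i` largest entries for some `i`, and the next largest
entry of `d` is smaller than that of `e`. -/
def SortedLexLT (d e : V → ℝ) : Prop :=
  ∃ m < Fintype.card V, (∀ i < m, nthLargest d i = nthLargest e i) ∧ nthLargest d m < nthLargest e m

theorem SortedLexLT.asymm {d e : V → ℝ} (h : SortedLexLT d e) : ¬ SortedLexLT e d := by
  rintro ⟨m', _, h1', h2'⟩
  obtain ⟨m, _, h1, h2⟩ := h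
  rcases lt_trichotomy m m' with hm | rfl | hm
  · exact h2.ne' (h1' _ hm)
  · exact h2.not_gt h2'
  · exact h2'.ne' (h1 _ hm)

/-- The entries of d that are at least t form a common initial block of both sorted lists. The entry
right after it is below t for d and at least t for e. -/
theorem sortedLexLT_of_threshold {d e : V → ℝ} {t : ℝ} (h1 : ∀ v, t ≤ d v → e v = d v)
    (h2 : ∀ v, d v < t → e v ≤ t) (h3 : ∃ v, d v < t ∧ t ≤ e v) : SortedLexLT d e := by
  obtain ⟨u, hu, hu'⟩ := h3
  have hd := sort_map_univ_split d (fun v => t ≤ d v) fun u v hu hv => by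
    rw [not_le] at hv
    linarith
  have he := sort_map_univ_split e (fun v => t ≤ d v) fun u v hu hv => by
    rw [h1 u hu]
    exact (h2 v (not_le.1 hv)).trans hu
  have hmap : (univ.filter fun v => t ≤ d v).val.map e =
      (univ.filter fun v => t ≤ d v).val.map d :=
    Multiset.map_congr rfl fun v hv => h1 v (by simpa using hv)
  rw [hmap] at he
  set l := ((univ.filter fun v => t ≤ d v).val.map d).sort (· ≥ ·) with hl
  have hulow : u ∈ univ.filter fun v => ¬ t ≤ d v := by simpa using hu
  have hlen : l.length < Fintype.card V := by
    rw [hl, Multiset.length_sort, Multiset.card_map]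
    refine card_lt_univ_of_notMem (x := u) ?_
    simpa using hu
  refine ⟨l.length, hlen, fun i hi => ?_, ?_⟩
  · rw [nthLargest, nthLargest, hd, he, List.getD_append _ _ _ _ hi, List.getD_append _ _ _ _ hi]
  · rw [nthLargest, nthLargest, hd, he, List.getD_append_right _ _ _ _ le_rfl,
      List.getD_append_right _ _ _ _ le_rfl, Nat.sub_self]
    -- Both remaining lists contain the value at `u`, so the default 0 of `getD` is never read.
    have hmem : ∀ k : V → ℝ, k u ∈
        ((univ.filter fun v => ¬ t ≤ d v).val.map k).sort (· ≥ ·) := fun k => by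
      rw [Multiset.mem_sort]
      exact Multiset.mem_map_of_mem k hulow
    have hlow : (((univ.filter fun v => ¬ t ≤ d v).val.map d).sort (· ≥ ·)).getD 0 0 < t := by
      obtain ⟨a, l', hal⟩ := List.exists_cons_of_ne_nil (List.ne_nil_of_mem (hmem d))
      have ha : a ∈ ((univ.filter fun v => ¬ t ≤ d v).val.map d).sort (· ≥ ·) :=
        hal ▸ List.mem_cons_self
      rw [hal, List.getD_cons_zero]
      rw [Multiset.mem_sort, Multiset.mem_map] at ha
      obtain ⟨v, hv, rfl⟩ := ha
      simpa using hv
    refine hlow.trans_le (hu'.trans ?_)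
    obtain ⟨a, l', hal⟩ := List.exists_cons_of_ne_nil (List.ne_nil_of_mem (hmem e))
    have hsort := Multiset.pairwise_sort
      ((univ.filter fun v => ¬ t ≤ d v).val.map e) (· ≥ ·)
    have hm := hmem e
    rw [hal] at hsort hm ⊢
    rw [List.getD_cons_zero]
    rcases List.mem_cons.1 hm with h | h
    · exact h.le
    · exact (List.pairwise_cons.1 hsort).1 _ h

end Levels

variable {V : Type*} [Fintype V] [DecidableEq V] {f g : Finset V → ℝ}

/-! ### Locally maximin allocations against all others -/

section Allocations

/-- The other agents bear at most g(V \ {v}) < g(V), so `v` bears something and densities are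
genuine quotients. -/
theorem cost_pos (hfg : IsDualModular f g) {a : (V → ℝ) × (V → ℝ)} (ha : a ∈ allocations f g)
    (v : V) : 0 < a.2 v := by
  have h1 := ha.2.2.2 (univ.erase v)
  have h2 := hfg.g_strictMono (erase_ssubset (mem_univ v))
  have h3 := add_sum_erase univ a.2 (mem_univ v)
  rw [ha.2.2.1] at h3
  linarith

theorem density_mul_cost (hfg : IsDualModular f g) {a : (V → ℝ) × (V → ℝ)}
    (ha : a ∈ allocations f g) (v : V) : density a v * a.2 v = a.1 v :=
  div_mul_cancel₀ _ (cost_pos hfg ha v).ne'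

theorem density_nonneg {a : (V → ℝ) × (V → ℝ)} (ha : a ∈ allocations f g) (v : V) :
    0 ≤ density a v :=
  div_nonneg (ha.1.1 v) (ha.2.1 v)

/-- On an upper level set, the costs of a locally maximin allocation dominate those of any other
allocation, also when weighted by the densities. -/
theorem IsLocallyMaximin.sum_density_sub_mul_nonneg {a b : (V → ℝ) × (V → ℝ)}
    (ha : IsLocallyMaximin f g a) (hb : b ∈ allocations f g) {t c : ℝ} (ht : 0 < t) (hc : c ≤ t) :
    0 ≤ ∑ v ∈ upperLevel a t, (density a v - c) * (a.2 v - b.2 v) := by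
  refine sum_superlevel_nonneg (density a) _ t (fun r hr => ?_) c hc
  have h1 := (ha.2 r (ht.trans_le hr)).2
  have h2 := hb.2.2.2 (upperLevel a r)
  rw [upperLevel] at h1 h2
  rw [sum_sub_distrib]
  linarith

theorem IsLocallyMaximin.sum_density_mul_le (hfg : IsDualModular f g) {a b : (V → ℝ) × (V → ℝ)}
    (ha : IsLocallyMaximin f g a) (hb : b ∈ allocations f g) {t : ℝ} (ht : 0 < t) :
    ∑ v ∈ upperLevel a t, density a v * b.2 v ≤ ∑ v ∈ upperLevel a t, b.1 v := by
  have h1 := ha.sum_density_sub_mul_nonneg hb ht ht.le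
  simp only [sub_zero, mul_sub, sum_sub_distrib, density_mul_cost hfg ha.1] at h1
  have h2 := (ha.2 t ht).1
  have h3 := hb.1.2.2 (upperLevel a t)
  linarith

/-- Allocations whose densities differ from those of a locally maximin one are lexicographically
worse. -/
theorem IsLocallyMaximin.sortedLexLT (hfg : IsDualModular f g) {a b : (V → ℝ) × (V → ℝ)}
    (ha : IsLocallyMaximin f g a) (hb : b ∈ allocations f g) (hne : density b ≠ density a) :
    SortedLexLT (density a) (density b) := by
  obtain ⟨v₀, hv₀⟩ := Function.ne_iff.1 hne
  obtain ⟨u, hu, hmax⟩ := exists_max_image (univ.filter fun v => density b v ≠ density a v)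
    (fun v => max (density a v) (density b v)) ⟨v₀, by simpa using hv₀⟩
  simp only [mem_filter, mem_univ, true_and] at hu hmax
  -- The highest level at which the two density vectors still differ. It is positive, as the larger
  -- of two distinct nonnegative numbers, so local maximinity applies at `t`.
  set t := max (density a u) (density b u) with ht
  have ht0 : 0 < t := by
    rcases lt_or_gt_of_ne hu with h | h
    · exact (density_nonneg hb u).trans_lt (h.trans_le (le_max_left _ _))
    · exact (density_nonneg ha.1 u).trans_lt (h.trans_le (le_max_right _ _))
  have hle : ∀ v ∈ upperLevel a t, density b v ≤ density a v := by
    intro v hv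
    by_contra! h
    have hv' : t ≤ density a v := by simpa [upperLevel] using hv
    have := (le_max_right _ _).trans (hmax v h.ne')
    linarith
  -- Termwise `density b ≤ density a` on this level set, while the sums weighted by the positive
  -- costs of `b` compare the other way.
  have heq : ∀ v, t ≤ density a v → density b v = density a v := by
    have hsum : ∑ v ∈ upperLevel a t, density b v * b.2 v =
        ∑ v ∈ upperLevel a t, density a v * b.2 v := by
      apply le_antisymm
      · exact sum_le_sum fun v hv => mul_le_mul_of_nonneg_right (hle v hv) (hb.2.1 v)
      · simp only [density_mul_cost hfg hb]
        exact ha.sum_density_mul_le hfg hb ht0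
    rw [sum_eq_sum_iff_of_le fun v hv =>
      mul_le_mul_of_nonneg_right (hle v hv) (hb.2.1 v)] at hsum
    intro v hv
    exact mul_right_cancel₀ (cost_pos hfg hb v).ne' (hsum v (by simpa [upperLevel] using hv))
  have hau : density a u < t := by
    by_contra! h
    exact hu (heq u h)
  refine sortedLexLT_of_threshold heq (fun v hv => ?_) ⟨u, hau, ?_⟩
  · by_cases h : density b v = density a v
    · rw [h]
      exact hv.le
    · exact (le_max_right _ _).trans (hmax v h)
  · rcases le_max_iff.1 ht.le with h | h
    · exact absurd h hau.not_ge
    · exact h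

theorem IsLocallyMaximin.density_eq (hfg : IsDualModular f g) {a b : (V → ℝ) × (V → ℝ)}
    (ha : IsLocallyMaximin f g a) (hb : IsLocallyMaximin f g b) : density b = density a := by
  by_contra hne
  exact (ha.sortedLexLT hfg hb.1 hne).asymm (hb.sortedLexLT hfg ha.1 (Ne.symm hne))

/-- With equal densities, the Abel inequality at c = r reads x_a(U) - x_b(U) ≥ r (y_a(U) - y_b(U)).
Feasibility of `b` makes the left side nonpositive and the right side nonnegative, so both vanish.
-/
theorem IsLocallyMaximin.of_density_eq (hfg : IsDualModular f g) {a b : (V → ℝ) × (V → ℝ)}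
    (ha : IsLocallyMaximin f g a) (hb : b ∈ allocations f g) (h : density b = density a) :
    IsLocallyMaximin f g b := by
  refine ⟨hb, fun r hr => ?_⟩
  have hlev : upperLevel b r = upperLevel a r := by rw [upperLevel, upperLevel, h]
  rw [hlev]
  have h1 := (ha.2 r hr).1
  have h2 := (ha.2 r hr).2
  have h3 := hb.1.2.2 (upperLevel a r)
  have h4 := hb.2.2.2 (upperLevel a r)
  have h5 := ha.sum_density_sub_mul_nonneg hb hr le_rfl
  have h6 : ∑ v ∈ upperLevel a r, (density a v - r) * (a.2 v - b.2 v) =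
      ∑ v ∈ upperLevel a r, a.1 v - ∑ v ∈ upperLevel a r, b.1 v
        - r * (∑ v ∈ upperLevel a r, a.2 v - ∑ v ∈ upperLevel a r, b.2 v) := by
    rw [← sum_sub_distrib, ← sum_sub_distrib, mul_sum, ← sum_sub_distrib]
    refine sum_congr rfl fun v _ => ?_
    rw [← density_mul_cost hfg ha.1, ← density_mul_cost hfg hb, h]
    ring
  have h7 : 0 ≤ r * (∑ v ∈ upperLevel a r, a.2 v - ∑ v ∈ upperLevel a r, b.2 v) :=
    mul_nonneg hr.le (by linarith)
  have h8 : r * (∑ v ∈ upperLevel a r, a.2 v - ∑ v ∈ upperLevel a r, b.2 v) = 0 := by linarith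
  rcases mul_eq_zero.1 h8 with h9 | h9
  · exact absurd h9 hr.ne'
  · constructor <;> linarith

/-- The two claims feed each other: if a survivor shares its first i entries with `a`, the
lexicographic comparison cannot be decided before entry i, so `a` is minimal there and survives. -/
theorem IsLocallyMaximin.mem_lexStage (hfg : IsDualModular f g) {a : (V → ℝ) × (V → ℝ)}
    (ha : IsLocallyMaximin f g a) (i : ℕ) : a ∈ lexStage f g i ∧
      ∀ b ∈ lexStage f g i, b ∈ allocations f g ∧
        ∀ j < i, nthLargest (density b) j = nthLargest (density a) j := by
  induction i with
  | zero => exact ⟨ha.1, fun b hb => ⟨hb, fun j hj => absurd hj j.not_lt_zero⟩⟩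
  | succ i ih =>
    have hle : ∀ b ∈ lexStage f g i,
        nthLargest (density a) i ≤ nthLargest (density b) i := by
      intro b hb
      obtain ⟨hb', hj⟩ := ih.2 b hb
      by_cases h : density b = density a
      · rw [h]
      obtain ⟨m, -, h1, h2⟩ := ha.sortedLexLT hfg hb' h
      rcases lt_trichotomy m i with hm | rfl | hm
      · exact absurd (hj m hm) h2.ne'
      · exact h2.le
      · exact (h1 i hm).le
    refine ⟨⟨ih.1, hle⟩, fun b hb => ⟨(ih.2 b hb.1).1, fun j hj => ?_⟩⟩
    rcases Nat.lt_succ_iff_lt_or_eq.1 hj with hj | rfl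
    · exact (ih.2 b hb.1).2 j hj
    · exact le_antisymm (hb.2 a ih.1) (hle b hb.1)

theorem mem_lexStage_of_density_eq {a b : (V → ℝ) × (V → ℝ)} (hb : b ∈ allocations f g)
    (h : density b = density a) (i : ℕ) (ha : a ∈ lexStage f g i) : b ∈ lexStage f g i := by
  induction i with
  | zero => exact hb
  | succ i ih => exact ⟨ih ha.1, by rw [h]; exact ha.2⟩

theorem IsLocallyMaximin.isLexOptimal_iff (hfg : IsDualModular f g) {a b : (V → ℝ) × (V → ℝ)}
    (ha : IsLocallyMaximin f g a) (hb : b ∈ allocations f g) :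
    IsLexOptimal f g b ↔ density b = density a := by
  refine ⟨fun h => ?_, fun h => mem_lexStage_of_density_eq hb h _ (ha.mem_lexStage hfg _).1⟩
  by_contra hne
  obtain ⟨m, hm, -, h2⟩ := ha.sortedLexLT hfg hb hne
  exact h2.ne' (((ha.mem_lexStage hfg _).2 b h).2 m hm)

theorem IsLocallyMaximin.isLocallyMaximin_iff (hfg : IsDualModular f g)
    {a b : (V → ℝ) × (V → ℝ)} (ha : IsLocallyMaximin f g a) (hb : b ∈ allocations f g) :
    IsLocallyMaximin f g b ↔ density b = density a :=
  ⟨ha.density_eq hfg, ha.of_density_eq hfg hb⟩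

end Allocations

/-! ### The density decomposition and its realization by an allocation -/

section Decomposition

theorem marginal_g_pos (hfg : IsDualModular f g) {A S : Finset V} (hS : S.Nonempty)
    (hSA : S ⊆ univ \ A) : 0 < marginal g A S := by
  obtain ⟨v, hv⟩ := hS
  refine sub_pos.2 (hfg.g_strictMono ?_)
  rw [ssubset_iff_of_subset subset_union_right]
  exact ⟨v, mem_union_left _ hv, (mem_sdiff.1 (hSA hv)).2⟩

theorem marginal_f_nonneg (hfg : IsDualModular f g) (A S : Finset V) : 0 ≤ marginal f A S :=
  sub_nonneg.2 (hfg.f_mono subset_union_right)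

theorem marginal_empty (h : Finset V → ℝ) (A : Finset V) : marginal h A ∅ = 0 := by
  simp [marginal]

theorem marginal_f_supermodular (hfg : IsDualModular f g) (A S T : Finset V) :
    marginal f A S + marginal f A T ≤ marginal f A (S ∩ T) + marginal f A (S ∪ T) := by
  have h := hfg.f_supermodular (S ∪ A) (T ∪ A)
  rw [← inter_union_distrib_right, ← union_union_distrib_right] at h
  unfold marginal
  linarith

theorem marginal_g_submodular (hfg : IsDualModular f g) (A S T : Finset V) :
    marginal g A (S ∩ T) + marginal g A (S ∪ T) ≤ marginal g A S + marginal g A T := by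
  have h := hfg.g_submodular (S ∪ A) (T ∪ A)
  rw [← inter_union_distrib_right, ← union_union_distrib_right] at h
  unfold marginal
  linarith

theorem marginalDensity_nonneg (hfg : IsDualModular f g) (A S : Finset V) :
    0 ≤ marginalDensity f g A S :=
  div_nonneg (marginal_f_nonneg hfg A S)
    (sub_nonneg.2 (hfg.g_strictMono.monotone subset_union_right))

namespace IsDensest

theorem marginal_f_eq (hfg : IsDualModular f g) {A S : Finset V} (h : IsDensest f g A S) :
    marginal f A S = marginalDensity f g A S * marginal g A S :=
  (div_mul_cancel₀ _ (marginal_g_pos hfg h.1.1 h.1.2).ne').symm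

theorem marginal_f_le (hfg : IsDualModular f g) {A S T : Finset V} (h : IsDensest f g A S)
    (hT : T ⊆ univ \ A) : marginal f A T ≤ marginalDensity f g A S * marginal g A T := by
  rcases T.eq_empty_or_nonempty with rfl | hne
  · simp [marginal_empty]
  · exact (div_le_iff₀ (marginal_g_pos hfg hne hT)).1 (h.2 T hne hT)

/-- The costs of a densest set can be split so that its elements have equal densities. -/
theorem exists_split (hfg : IsDualModular f g) {A S : Finset V} (h : IsDensest f g A S) :
    ∃ z : V → ℝ, ∑ v ∈ S, z v = marginal g A S ∧ ∀ T ⊆ S,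
      marginal f A T ≤ marginalDensity f g A S * ∑ v ∈ T, z v ∧
      ∑ v ∈ T, z v ≤ marginal g A T := by
  -- At density 0 there is no dividing by it, but the reward bound is trivial. Any base of g(· | A)
  -- on `S` serves, found between g(· | A) and its dual T ↦ g(S | A) - g(S \ T | A).
  rcases (marginalDensity_nonneg hfg A S).eq_or_lt' with h0 | hpos
  · obtain ⟨z, hz⟩ := exists_modular_between S (fun T => marginal g A S - marginal g A (S \ T))
      (marginal g A) (by simp) (marginal_empty g A)
      (by
        intro P _ Q _
        have := marginal_g_submodular hfg A (S \ P) (S \ Q)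
        rw [← sdiff_union_distrib, ← sdiff_inter_distrib_right] at this
        linarith)
      (fun P _ Q _ => marginal_g_submodular hfg A P Q)
      (by
        intro T hT
        have := marginal_g_submodular hfg A T (S \ T)
        rw [inter_sdiff_self, union_sdiff_of_subset hT, marginal_empty] at this
        linarith)
    refine ⟨z, ?_, fun T hT => ⟨?_, (hz T hT).2⟩⟩
    · have := hz S subset_rfl
      simp only [sdiff_self, bot_eq_empty, marginal_empty] at this
      linarith
    · have := h.marginal_f_le hfg (hT.trans h.1.2)
      rw [h0, zero_mul] at this ⊢
      exact this
  · set r := marginalDensity f g A S with hr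
    obtain ⟨z, hz⟩ := exists_modular_between S (fun T => marginal f A T / r)
      (marginal g A) (by simp [marginal_empty]) (marginal_empty g A)
      (by
        intro P _ Q _
        rw [← add_div, ← add_div]
        exact div_le_div_of_nonneg_right (marginal_f_supermodular hfg A P Q) hpos.le)
      (fun P _ Q _ => marginal_g_submodular hfg A P Q)
      (fun T hT => (div_le_iff₀' hpos).2 (h.marginal_f_le hfg (hT.trans h.1.2)))
    refine ⟨z, ?_, fun T hT => ⟨(div_le_iff₀' hpos).1 (hz T hT).1, (hz T hT).2⟩⟩
    have := hz S subset_rfl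
    rw [h.marginal_f_eq hfg, ← hr, mul_div_cancel_left₀ _ hpos.ne'] at this
    exact le_antisymm this.2 this.1

end IsDensest

/-- The union of the parts with index less than `j`. -/
def prefixUnion {k : ℕ} (S : Fin k → Finset V) (j : ℕ) : Finset V :=
  (univ.filter fun i : Fin k => (i : ℕ) < j).biUnion S

theorem mem_prefixUnion {k : ℕ} {S : Fin k → Finset V} {j : ℕ} {v : V} :
    v ∈ prefixUnion S j ↔ ∃ i : Fin k, (i : ℕ) < j ∧ v ∈ S i := by
  simp [prefixUnion]

theorem prefixUnion_zero {k : ℕ} (S : Fin k → Finset V) : prefixUnion S 0 = ∅ := by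
  simp [prefixUnion]

theorem prefixUnion_succ {k : ℕ} (S : Fin k → Finset V) (i : Fin k) :
    prefixUnion S (i + 1) = S i ∪ prefixUnion S i := by
  ext v
  simp only [mem_union, mem_prefixUnion, Nat.lt_succ_iff_lt_or_eq]
  constructor
  · rintro ⟨j, hj | hj, hv⟩
    · exact Or.inr ⟨j, hj, hv⟩
    · exact Or.inl (Fin.ext hj ▸ hv)
  · rintro (hv | ⟨j, hj, hv⟩)
    · exact ⟨i, Or.inr rfl, hv⟩
    · exact ⟨j, Or.inl hj, hv⟩

namespace IsDensityDecomposition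

variable {k : ℕ} {S : Fin k → Finset V} {ρ : V → ℝ}

theorem isDensest (h : IsDensityDecomposition f g S ρ) (i : Fin k) :
    IsDensest f g (prefixUnion S i) (S i) :=
  (h.maximal_densest i).prop

theorem density_eq' (h : IsDensityDecomposition f g S ρ) (i : Fin k) {v : V} (hv : v ∈ S i) :
    ρ v = marginalDensity f g (prefixUnion S i) (S i) :=
  h.density_eq i v hv

theorem prefixUnion_length (h : IsDensityDecomposition f g S ρ) : prefixUnion S k = univ := by
  rw [← h.exhausts]
  simp [prefixUnion]

theorem exists_mem (h : IsDensityDecomposition f g S ρ) (v : V) : ∃ i, v ∈ S i := by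
  have : v ∈ univ.biUnion S := h.exhausts ▸ mem_univ v
  simpa using this

theorem nonneg (hfg : IsDualModular f g) (h : IsDensityDecomposition f g S ρ) (v : V) :
    0 ≤ ρ v := by
  obtain ⟨i, hi⟩ := h.exists_mem v
  rw [h.density_eq' i hi]
  exact marginalDensity_nonneg hfg _ _

/-- A next part of larger density would make its union with the current part denser than the current
part alone. -/
theorem marginalDensity_antitone (hfg : IsDualModular f g) (h : IsDensityDecomposition f g S ρ) :
    Antitone fun i : Fin k => marginalDensity f g (prefixUnion S i) (S i) := by
  rcases k with _ | k
  · exact fun i => i.elim0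
  refine Fin.antitone_iff_succ_le.2 fun i => ?_
  have hi := h.isDensest i.castSucc
  have hj := h.isDensest i.succ
  have hA := prefixUnion_succ S i.castSucc
  simp only [Fin.val_castSucc, Fin.val_succ] at hi hj hA ⊢
  set A := prefixUnion S i
  rw [hA] at hj ⊢
  have hle := hi.marginal_f_le hfg (T := S i.succ ∪ S i.castSucc)
    (union_subset (hj.1.2.trans (sdiff_subset_sdiff subset_rfl subset_union_right)) hi.1.2)
  have heq := hi.marginal_f_eq hfg
  rw [marginalDensity, div_le_iff₀ (marginal_g_pos hfg hj.1.1 hj.1.2)]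
  unfold marginal at hle heq ⊢
  rw [← union_assoc]
  linarith

/-- The upper level sets of the density vector are unions of initial segments of parts. -/
theorem exists_superlevel_eq (hfg : IsDualModular f g) (h : IsDensityDecomposition f g S ρ)
    (r : ℝ) : ∃ j ≤ k, (univ.filter fun v => r ≤ ρ v) = prefixUnion S j := by
  classical
  -- The least such `j` is the first part of density below `r`, or `k` if there is none.
  have hex : ∃ j : ℕ, ∀ hj : j < k,
      marginalDensity f g (prefixUnion S j) (S ⟨j, hj⟩) < r := ⟨k, fun hk => absurd hk (lt_irrefl k)⟩
  have hspec := Nat.find_spec hex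
  have hmin := fun m => Nat.find_min hex (m := m)
  have hle : Nat.find hex ≤ k := Nat.find_min' hex fun hk => absurd hk (lt_irrefl k)
  set j := Nat.find hex
  refine ⟨j, hle, ?_⟩
  ext v
  obtain ⟨i, hi⟩ := h.exists_mem v
  simp only [mem_filter, mem_univ, true_and, mem_prefixUnion]
  constructor
  · intro hv
    refine ⟨i, ?_, hi⟩
    by_contra! hji
    have hjk : j < k := hji.trans_lt i.2
    have h1 := hspec hjk
    have h2 := h.marginalDensity_antitone hfg (show (⟨j, hjk⟩ : Fin k) ≤ i from hji)
    rw [h.density_eq' i hi] at hv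
    exact absurd (hv.trans h2) (not_le.2 h1)
  · rintro ⟨i', hi', hv⟩
    have := hmin i' hi'
    push Not at this
    obtain ⟨_, h1⟩ := this
    rw [h.density_eq' i' hv]
    exact h1

/-- Gluing stays feasible since f(T) ≤ f(T ∩ A) + f(T \ A | A) by supermodularity, and dually for g.
Tightness of all shorter prefixes is carried along for the level sets. -/
theorem exists_prefix_allocation (hfg : IsDualModular f g) (h : IsDensityDecomposition f g S ρ)
    (j : ℕ) (hj : j ≤ k) : ∃ y : V → ℝ,
      (∀ T ⊆ prefixUnion S j, f T ≤ ∑ v ∈ T, ρ v * y v ∧ ∑ v ∈ T, y v ≤ g T) ∧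
      ∀ i ≤ j, ∑ v ∈ prefixUnion S i, ρ v * y v = f (prefixUnion S i) ∧
        ∑ v ∈ prefixUnion S i, y v = g (prefixUnion S i) := by
  induction j with
  | zero =>
    refine ⟨0, fun T hT => ?_, fun i hi => ?_⟩
    · rw [prefixUnion_zero, subset_empty] at hT
      simp [hT, hfg.f_empty, hfg.g_empty]
    · simp [Nat.le_zero.1 hi, prefixUnion_zero, hfg.f_empty, hfg.g_empty]
  | succ j ih =>
    obtain ⟨y, hy, hy'⟩ := ih (by omega)
    have hD := h.isDensest ⟨j, hj⟩
    have hA := prefixUnion_succ S ⟨j, hj⟩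
    have hρ : ∀ v ∈ S ⟨j, hj⟩, ρ v = _ := fun v => h.density_eq' ⟨j, hj⟩
    obtain ⟨z, hzS, hz⟩ := hD.exists_split hfg
    have hfS := hD.marginal_f_eq hfg
    have htight := hy' j le_rfl
    have hmono : ∀ i ≤ j, prefixUnion S i ⊆ prefixUnion S j := fun i hi v hv => by
      obtain ⟨l, hl, hv⟩ := mem_prefixUnion.1 hv
      exact mem_prefixUnion.2 ⟨l, hl.trans_le hi, hv⟩
    simp only at hD hA hρ hzS hz hfS
    set A := prefixUnion S j
    set B := S ⟨j, hj⟩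
    set r := marginalDensity f g A B
    have hBA : ∀ v ∈ B, v ∉ A := fun v hv => (mem_sdiff.1 (hD.1.2 hv)).2
    set y' : V → ℝ := fun v => if v ∈ A then y v else z v with hy'def
    have hin : ∀ T ⊆ A, ∑ v ∈ T, ρ v * y' v = ∑ v ∈ T, ρ v * y v ∧
        ∑ v ∈ T, y' v = ∑ v ∈ T, y v := fun T hT =>
      ⟨sum_congr rfl fun v hv => by simp [hy'def, hT hv],
        sum_congr rfl fun v hv => by simp [hy'def, hT hv]⟩
    have hout : ∀ T ⊆ B, ∑ v ∈ T, ρ v * y' v = r * ∑ v ∈ T, z v ∧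
        ∑ v ∈ T, y' v = ∑ v ∈ T, z v := fun T hT =>
      ⟨by
        rw [mul_sum]
        exact sum_congr rfl fun v hv => by simp [hy'def, hBA v (hT hv), hρ v (hT hv)],
        sum_congr rfl fun v hv => by simp [hy'def, hBA v (hT hv)]⟩
    refine ⟨y', fun T hT => ?_, fun i hi => ?_⟩
    · rw [hA] at hT
      have hTB : T \ A ⊆ B := fun v hv => by
        obtain ⟨h1, h2⟩ := mem_sdiff.1 hv
        exact (mem_union.1 (hT h1)).resolve_right h2
      have hs : ∀ w : V → ℝ, ∑ v ∈ T, w v = ∑ v ∈ T ∩ A, w v + ∑ v ∈ T \ A, w v := fun w =>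
        (sum_inter_add_sum_sdiff T A w).symm
      have h1 := hy (T ∩ A) inter_subset_right
      have h2 := hz _ hTB
      have h3 := hfg.f_supermodular T A
      have h4 := hfg.g_submodular T A
      rw [hs, hs y', (hin _ inter_subset_right).1, (hin _ inter_subset_right).2,
        (hout _ hTB).1, (hout _ hTB).2]
      rw [marginal, marginal, sdiff_union_self_eq_union] at h2
      constructor <;> linarith
    · rcases hi.eq_or_lt with rfl | hi
      · rw [hA, union_comm, sum_union (disjoint_right.2 hBA), sum_union (disjoint_right.2 hBA),
          (hin A subset_rfl).1, (hin A subset_rfl).2, (hout B subset_rfl).1,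
          (hout B subset_rfl).2, htight.1, htight.2, hzS, ← hfS, marginal, marginal, union_comm]
        constructor <;> ring
      · have hi' := Nat.lt_succ_iff.1 hi
        rw [(hin _ (hmono i hi')).1, (hin _ (hmono i hi')).2]
        exact hy' i hi'

theorem exists_isLocallyMaximin (hfg : IsDualModular f g) (h : IsDensityDecomposition f g S ρ) :
    ∃ a, IsLocallyMaximin f g a ∧ density a = ρ := by
  obtain ⟨y, hy, hy'⟩ := h.exists_prefix_allocation hfg k le_rfl
  rw [h.prefixUnion_length] at hy
  have htot := hy' k le_rfl
  rw [h.prefixUnion_length] at htot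
  -- The sandwich theorem says nothing about signs; positivity comes from the tight total and strict
  -- monotonicity of g.
  have hpos : ∀ v, 0 < y v := fun v => by
    have h1 := (hy (univ.erase v) (subset_univ _)).2
    have h2 := hfg.g_strictMono (erase_ssubset (mem_univ v))
    have h3 := add_sum_erase univ y (mem_univ v)
    linarith [htot.2]
  have hd : density (fun v => ρ v * y v, y) = ρ :=
    funext fun v => mul_div_cancel_right₀ _ (hpos v).ne'
  refine ⟨(fun v => ρ v * y v, y), ⟨⟨⟨fun v => mul_nonneg (h.nonneg hfg v) (hpos v).le, htot.1,
    fun T => (hy T (subset_univ _)).1⟩, fun v => (hpos v).le, htot.2,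
    fun T => (hy T (subset_univ _)).2⟩, fun r _ => ?_⟩, hd⟩
  obtain ⟨j, hj, hlev⟩ := h.exists_superlevel_eq hfg r
  rw [upperLevel, hd, hlev]
  exact hy' j hj

end IsDensityDecomposition

theorem exists_maximal_isDensest (f g : Finset V → ℝ) {A : Finset V} (hA : A ≠ univ) :
    ∃ S, Maximal (IsDensest f g A) S := by
  obtain ⟨v, hv⟩ : ∃ v, v ∉ A := by
    by_contra! h
    exact hA (eq_univ_iff_forall.2 h)
  obtain ⟨S, hS, hmax⟩ := exists_max_image
    (univ.filter fun S : Finset V => S.Nonempty ∧ S ⊆ univ \ A) (marginalDensity f g A)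
    ⟨{v}, by simp [hv]⟩
  simp only [mem_filter, mem_univ, true_and] at hS hmax
  obtain ⟨M, -, hM⟩ := (Set.toFinite {S | IsDensest f g A S}).exists_le_maximal
    (show S ∈ {S | IsDensest f g A S} from ⟨hS, fun T h1 h2 => hmax T ⟨h1, h2⟩⟩)
  exact ⟨M, hM⟩

theorem exists_isDensityVector (f g : Finset V → ℝ) : ∃ ρ, IsDensityVector f g ρ := by
  classical
  choose! nxt hnxt using fun (A : Finset V) (hA : A ≠ univ) => exists_maximal_isDensest f g hA
  -- The prefixes of the procedure. Each step adds an element until `univ` is reached, and the parts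
  -- are cut off at the first such time `k`, before `nxt` loses its meaning.
  let A : ℕ → Finset V := fun n => (fun B => nxt B ∪ B)^[n] ∅
  have hAs : ∀ n, A (n + 1) = nxt (A n) ∪ A n := fun n => Function.iterate_succ_apply' _ _ _
  have hcard : ∀ n, A n = univ ∨ n ≤ #(A n) := by
    intro n
    induction n with
    | zero => exact Or.inr (Nat.zero_le _)
    | succ n ih =>
      by_cases hn : A n = univ
      · left
        rw [hAs, hn]
        simp
      · right
        have h1 := (hnxt _ hn).prop.1
        rw [hAs, card_union_of_disjoint (disjoint_left.2 fun v hv => (mem_sdiff.1 (h1.2 hv)).2)]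
        have := h1.1.card_pos
        have := ih.resolve_left hn
        omega
  have hex : ∃ n, A n = univ := by
    refine ⟨Fintype.card V + 1, (hcard _).resolve_right fun h => ?_⟩
    have := card_le_univ (A (Fintype.card V + 1))
    omega
  set k := Nat.find hex with hk
  have hne : ∀ i : Fin k, A i ≠ univ := fun i => Nat.find_min hex i.2
  let S : Fin k → Finset V := fun i => nxt (A i)
  have hpre : ∀ j ≤ k, prefixUnion S j = A j := by
    intro j
    induction j with
    | zero => exact fun _ => prefixUnion_zero S
    | succ j ih =>
      intro hj
      have := prefixUnion_succ S ⟨j, hj⟩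
      rw [this, hAs]
      simp only [ih (by omega), S]
  have hpre' : ∀ i : Fin k, precedingUnion S i = A i := fun i => hpre i i.2.le
  have hmem : ∀ v, ∃ i, v ∈ S i := fun v => by
    have hv : v ∈ prefixUnion S k := by
      rw [hpre k le_rfl, Nat.find_spec hex]
      exact mem_univ v
    obtain ⟨i, -, hi⟩ := mem_prefixUnion.1 hv
    exact ⟨i, hi⟩
  choose idx hidx using hmem
  have hlt : ∀ i j : Fin k, i < j → ∀ v ∈ S i, v ∉ S j := by
    intro i j hij v hi hj
    have h1 := (mem_sdiff.1 ((hnxt _ (hne j)).prop.1.2 hj)).2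
    rw [← hpre j j.2.le] at h1
    exact h1 (mem_prefixUnion.2 ⟨i, hij, hi⟩)
  refine ⟨fun v => marginalDensity f g (precedingUnion S (idx v)) (S (idx v)), k, S, ?_, ?_, ?_⟩
  · intro i
    rw [hpre']
    exact hnxt _ (hne i)
  · exact eq_univ_iff_forall.2 fun v => mem_biUnion.2 ⟨idx v, mem_univ _, hidx v⟩
  · intro i v hv
    have : idx v = i := by
      rcases lt_trichotomy (idx v) i with hi | hi | hi
      · exact absurd hv (hlt _ _ hi v (hidx v))
      · exact hi
      · exact absurd (hidx v) (hlt _ _ hi v hv)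
    simp only [this]

end Decomposition

end DualModular

theorem theorem1 {V : Type*} [Fintype V] [DecidableEq V] (f g : Finset V → ℝ)
    (hfg : DualModular.IsDualModular f g) :
    -- the density vector is well defined
    (∃! ρ : V → ℝ, DualModular.IsDensityVector f g ρ) ∧
    ∀ ρ : V → ℝ, DualModular.IsDensityVector f g ρ →
      -- the equivalence
      (∀ a ∈ DualModular.allocations f g,
        List.TFAE [
          ∀ v, DualModular.density a v = ρ v,
          DualModular.IsLexOptimal f g a,
          DualModular.IsLocallyMaximin f g a]) ∧
      -- the existence of such allocations
      ∃ a ∈ DualModular.allocations f g,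
        (∀ v, DualModular.density a v = ρ v) ∧
        DualModular.IsLexOptimal f g a ∧ DualModular.IsLocallyMaximin f g a := by
  have key : ∀ ρ, DualModular.IsDensityVector f g ρ →
      ∃ a, DualModular.IsLocallyMaximin f g a ∧ DualModular.density a = ρ :=
    fun ρ ⟨_, _, h⟩ => h.exists_isLocallyMaximin hfg
  refine ⟨?_, fun ρ hρ => ?_⟩
  -- Uniqueness is not read off the procedure: two density vectors are both realized by locally
  -- maximin allocations, whose densities coincide.
  · obtain ⟨ρ, hρ⟩ := DualModular.exists_isDensityVector f g
    refine ⟨ρ, hρ, fun ρ' hρ' => ?_⟩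
    obtain ⟨a, ha, rfl⟩ := key ρ hρ
    obtain ⟨b, hb, rfl⟩ := key ρ' hρ'
    exact ha.density_eq hfg hb
  · obtain ⟨a, ha, rfl⟩ := key ρ hρ
    refine ⟨fun b hb => ?_, a, ha.1, fun _ => rfl, (ha.isLexOptimal_iff hfg ha.1).2 rfl, ha⟩
    rw [← funext_iff, ← ha.isLexOptimal_iff hfg hb, ha.isLocallyMaximin_iff hfg hb,
      ha.isLexOptimal_iff hfg hb]
    tfae_finish
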